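/- Consider a game with $N$ players; player $i$ chooses $x_i\in\mathbb{R}^{n_i}$ and has cost $J_i(x_i,x_{-i})$, $J_i:\mathbb{R}^n\to\mathbb{R}$, $n=\sum_i n_i$. Assume that every $J_i$ is $C^1$ and, for every fixed $x_{-i}$, is convex and radially unbounded in $x_i$. Let $F(x)=(\nabla_{x_1}J_1(x),\dots,\nabla_{x_N}J_N(x))$ be the pseudo-gradient. Assume that $F$ is Lipschitz, that it is $R$-inverse Lipschitz for some $R>0$, i.e. $\|x-y\|\le R\|F(x)-F(y)\|$ for all $x,y\in\mathbb{R}^n$, and that it is $\mu$-hypomonotone for some $\mu\ge 0$, i.e. $\langle F(x)-F(y),x-y\rangle\ge-\mu\|x-y\|^2$ for all $x,y\in\mathbb{R}^n$. Let $0<d<1$, let $\beta\in\left(\mu,\frac{1}{\mu R^2}\right)$ (with $\frac{1}{\mu R^2}=\infty$ if $\mu=0$), put $\lambda=1/\beta$ and $$L_{\mathcal J}=\sqrt{\frac{R^2}{R^2+\lambda^2-2\lambda\mu R^2}},\qquad \kappa_{\mathcal J}=\begin{cases}\dfrac{R^2(1-\mu\lambda)}{R^2+\lambda^2-2\mu\lambda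 R^2}, & R\ge\lambda,\\[2ex] \dfrac{R^2\left(1+\frac{\lambda}{R}\right)}{R^2+\lambda^2+2\lambda R}, & \lambda\ge R,\end{cases}$$ and let $$0<\alpha<\frac{4d(1-d)(\beta-\mu)(1-\kappa_{\mathcal J})}{\left((1-d)+d(L_{\mathcal J}+L_{\mathcal J}^2)\right)^2}.$$ Then the full-information Heavy Anchor dynamics $$\dot r=\alpha(x-r),\qquad \dot x=-F(x)-\beta(x-r)$$ converge globally to a Nash equilibrium: there is a Nash equilibrium $x^*$, i.e. $J_i(x_i^*,x_{-i}^*)\le J_i(y_i,x_{-i}^*)$ for all $i$ and all $y_i\in\mathbb{R}^{n_i}$, such that for every initial condition $(r_0,x_0)\in\mathbb{R}^n\times\mathbb{R}^n$ the dynamics have a solution on $[0,\infty)$, and every solution $(r,x)$ on $[0,\infty)$ satisfies $x(t)\to x^*$ and $r(t)\to x^*$ as $t\to\infty$. -/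

import Mathlib

open Set Filter Topology
open scoped NNReal

/-- Joint action profiles of `N` players, player `i` having action space `ℝ^{n i}`; this is
`ℝ^{n 1 + ... + n N}` with its Euclidean inner product and norm. -/
abbrev Profile {N : ℕ} (n : Fin N → ℕ) : Type :=
  PiLp 2 (fun i : Fin N => EuclideanSpace ℝ (Fin (n i)))

/-- The profile `(y, x_{-i})`: player `i` plays `y`, all others play as in `x`. -/
def deviate {N : ℕ} {n : Fin N → ℕ} (x : Profile n) (i : Fin N)
    (y : EuclideanSpace ℝ (Fin (n i))) : Profile n :=
  WithLp.toLp 2 (Function.update (WithLp.ofLp x) i y)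

/-- `x` is a Nash equilibrium of the game with costs `J i`. -/
def IsNashEquilibrium {N : ℕ} {n : Fin N → ℕ} (J : Fin N → Profile n → ℝ)
    (x : Profile n) : Prop :=
  ∀ (i : Fin N) (y : EuclideanSpace ℝ (Fin (n i))), J i x ≤ J i (deviate x i y)

/-- The pseudo-gradient: stack of the partial gradients of `J i` with respect to the action of
player `i`. -/
noncomputable def pseudoGradient {N : ℕ} {n : Fin N → ℕ} (J : Fin N → Profile n → ℝ)
    (x : Profile n) : Profile n :=
  WithLp.toLp 2 (fun i => gradient (fun y => J i (deviate x i y)) (x i))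

/-- Each cost is `C¹`, and is convex and radially unbounded in the own action for all fixed actions
of the other players. -/
structure CostAssumption {N : ℕ} {n : Fin N → ℕ} (J : Fin N → Profile n → ℝ) : Prop where
  contDiff : ∀ i, ContDiff ℝ 1 (J i)
  convex : ∀ i x, ConvexOn ℝ univ (fun y => J i (deviate x i y))
  radiallyUnbounded : ∀ i x,
    Tendsto (fun y => J i (deviate x i y)) (Bornology.cobounded _) atTop

/-- `T` is `μ`-hypomonotone (`μ ≥ 0`; monotone if `μ = 0`). -/
def IsHypomonotone {E : Type*} [NormedAddCommGroup E] [InnerProductSpace ℝ E]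
    (μ : ℝ) (T : E → E) : Prop :=
  0 ≤ μ ∧ ∀ x y, -μ * ‖x - y‖ ^ 2 ≤ inner ℝ (T x - T y) (x - y)

/-- `T` is `R`-inverse Lipschitz. -/
def IsInverseLipschitz {E : Type*} [NormedAddCommGroup E] (R : ℝ) (T : E → E) : Prop :=
  ∀ x y, ‖x - y‖ ≤ R * ‖T x - T y‖

/-- The constant `L_𝒥`. -/
noncomputable def resolventLip (μ R lam : ℝ) : ℝ :=
  √(R ^ 2 / (R ^ 2 + lam ^ 2 - 2 * lam * μ * R ^ 2))

/-- The constant `κ_𝒥`; both formulas give `1/2` at `lam = R`. -/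
noncomputable def resolventKappa (μ R lam : ℝ) : ℝ :=
  if lam ≤ R then
    R ^ 2 * (1 - μ * lam) / (R ^ 2 + lam ^ 2 - 2 * μ * lam * R ^ 2)
  else
    R ^ 2 * (1 + lam / R) / (R ^ 2 + lam ^ 2 + 2 * lam * R)

/-- `(r, x)` solves `r' = α (x - r)`, `x' = -F x - β (x - r)` on `[0, ∞)`. -/
def IsHeavyAnchorSolution {E : Type*} [NormedAddCommGroup E] [NormedSpace ℝ E]
    (F : E → E) (α β : ℝ) (r x : ℝ → E) : Prop :=
  ∀ t, 0 ≤ t →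
    HasDerivWithinAt r (α • (x t - r t)) (Ici 0) t ∧
    HasDerivWithinAt x (-F (x t) - β • (x t - r t)) (Ici 0) t

/-! For a frozen anchor `r`, the `x`-equation rests at `G r`, where `G = (id + β⁻¹ F)⁻¹`; this
resolvent exists because `F + β id` is strongly monotone for `β > μ`. Its fixed points are the zeros
of `F`, which are Nash equilibria by convexity. The bound `β < 1/(μR²)` gives `κ < 1` in `⟪G r - G
s, r - s⟫ ≤ κ‖r - s‖²`, so `id - G` is strongly monotone and `G` has a fixed point `p`.

Convergence follows from a weighted sum `V` of `‖r - p‖²` and `‖x - G r‖²`. Along solutions its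
slope is at most a quadratic form in `‖r - p‖` and `‖x - G r‖`, and the bound on `α` says exactly
that this form is negative definite; Grönwall then gives exponential decay. As `G` is merely
Lipschitz, `V` need not be differentiable, so difference quotients are estimated instead, using
monotonicity of `G` (`neg_inner_sub_le_of_monotone`). -/

/-! ### Global solutions of Lipschitz autonomous ODEs. -/

section GlobalExistence

variable {E : Type*} [NormedAddCommGroup E] [NormedSpace ℝ E]

/-- The step length depends on `K` alone, not on `y₀`, so finitely many steps cover any bounded
interval. -/
lemma exists_hasDerivWithinAt_Icc_of_lipschitzWith [CompleteSpace E] {f : E → E} {K : ℝ≥0}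
    (hf : LipschitzWith K f) (y₀ : E) (s : ℝ) :
    ∃ y : ℝ → E, y s = y₀ ∧ ∀ t ∈ Icc s (s + 1 / (K + 1)),
      HasDerivWithinAt y (f (y t)) (Icc s (s + 1 / (K + 1))) t := by
  have hK : (0 : ℝ) < K + 1 := by positivity
  have hs : s ∈ Icc s (s + 1 / ((K : ℝ) + 1)) := ⟨le_rfl, by
    have : 0 < 1 / ((K : ℝ) + 1) := by positivity
    linarith⟩
  -- On the ball of radius `‖f y₀‖ + 1` the speed is at most `(K + 1)‖f y₀‖ + K`, so time `1/(K +
  -- 1)` is too short to leave it.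
  have hP : IsPicardLindelof (fun _ ↦ f) (⟨s, hs⟩ : Icc s (s + 1 / ((K : ℝ) + 1))) y₀
      (‖f y₀‖₊ + 1) 0 (‖f y₀‖₊ + K * (‖f y₀‖₊ + 1)) K := by
    refine IsPicardLindelof.of_time_independent ?_ hf.lipschitzOnWith ?_
    · intro x hx
      have h1 : ‖f x - f y₀‖ ≤ K * ‖x - y₀‖ := hf.norm_sub_le x y₀
      rw [Metric.mem_closedBall, dist_eq_norm] at hx
      have h2 : (K : ℝ) * ‖x - y₀‖ ≤ K * (‖f y₀‖ + 1) :=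
        mul_le_mul_of_nonneg_left (by simpa using hx) K.2
      have h3 := norm_le_norm_add_norm_sub' (f x) (f y₀)
      push_cast
      linarith
    · have h0 : 0 < 1 / ((K : ℝ) + 1) := by positivity
      simp only [add_sub_cancel_left, sub_self, max_eq_left h0.le]
      push_cast
      rw [sub_zero]
      rw [mul_one_div, div_le_iff₀ hK]
      nlinarith [norm_nonneg (f y₀), K.2]
  exact hP.exists_eq_forall_mem_Icc_hasDerivWithinAt₀

lemma exists_hasDerivWithinAt_Icc_concat {f : E → E} {a b c : ℝ} (hab : a ≤ b) (hbc : b ≤ c)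
    {y z : ℝ → E} (hy : ∀ t ∈ Icc a b, HasDerivWithinAt y (f (y t)) (Icc a b) t)
    (hz : ∀ t ∈ Icc b c, HasDerivWithinAt z (f (z t)) (Icc b c) t) (hyz : z b = y b) :
    ∃ u : ℝ → E, u a = y a ∧ ∀ t ∈ Icc a c, HasDerivWithinAt u (f (u t)) (Icc a c) t := by
  classical
  set u : ℝ → E := fun t ↦ if t ≤ b then y t else z t with hu
  have huy : ∀ t ∈ Icc a b, u t = y t := fun t ht ↦ if_pos ht.2
  have huz : ∀ t ∈ Icc b c, u t = z t := by
    intro t ht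
    rcases ht.1.eq_or_lt with rfl | h
    · simp [hu, hyz]
    · simp [hu, not_le.mpr h]
  refine ⟨u, huy a ⟨le_rfl, hab⟩, fun t ht ↦ ?_⟩
  have h1 : t ≤ b → HasDerivWithinAt u (f (u t)) (Icc a b) t := fun h ↦ by
    have := (hy t ⟨ht.1, h⟩).congr huy (huy t ⟨ht.1, h⟩)
    rwa [huy t ⟨ht.1, h⟩]
  have h2 : b ≤ t → HasDerivWithinAt u (f (u t)) (Icc b c) t := fun h ↦ by
    have := (hz t ⟨h, ht.2⟩).congr huz (huz t ⟨h, ht.2⟩)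
    rwa [huz t ⟨h, ht.2⟩]
  rcases lt_trichotomy t b with h | h | h
  · refine (h1 h.le).mono_of_mem_nhdsWithin ?_
    filter_upwards [self_mem_nhdsWithin, mem_nhdsWithin_of_mem_nhds (Iio_mem_nhds h)] with s hs hs'
    exact ⟨hs.1, le_of_lt hs'⟩
  · rw [← Icc_union_Icc_eq_Icc hab hbc]
    exact (h1 h.le).union (h2 h.ge)
  · refine (h2 h.le).mono_of_mem_nhdsWithin ?_
    filter_upwards [self_mem_nhdsWithin, mem_nhdsWithin_of_mem_nhds (Ioi_mem_nhds h)] with s hs hs'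
    exact ⟨le_of_lt hs', hs.2⟩

/-- A globally Lipschitz autonomous ODE has a solution on `[0, ∞)` for each initial value. -/
theorem exists_hasDerivWithinAt_Ici_of_lipschitzWith [CompleteSpace E] {f : E → E} {K : ℝ≥0}
    (hf : LipschitzWith K f) (y₀ : E) :
    ∃ y : ℝ → E, y 0 = y₀ ∧ ∀ t, 0 ≤ t → HasDerivWithinAt y (f (y t)) (Ici 0) t := by
  have hδ : 0 < 1 / ((K : ℝ) + 1) := by positivity
  have key : ∀ k : ℕ, ∃ y : ℝ → E, y 0 = y₀ ∧ ∀ t ∈ Icc 0 (k * (1 / ((K : ℝ) + 1))),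
      HasDerivWithinAt y (f (y t)) (Icc 0 (k * (1 / ((K : ℝ) + 1)))) t := by
    intro k
    induction k with
    | zero =>
      refine ⟨fun _ ↦ y₀, rfl, fun t ht ↦ ?_⟩
      have ht0 : t = 0 := by
        rw [Nat.cast_zero, zero_mul] at ht
        exact le_antisymm ht.2 ht.1
      subst ht0
      rw [Nat.cast_zero, zero_mul, Icc_self]
      exact HasFDerivWithinAt.of_subsingleton subsingleton_singleton
    | succ k ih =>
      obtain ⟨y, hy0, hy⟩ := ih
      obtain ⟨z, hz0, hz⟩ := exists_hasDerivWithinAt_Icc_of_lipschitzWith hf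
        (y (k * (1 / ((K : ℝ) + 1)))) (k * (1 / ((K : ℝ) + 1)))
      obtain ⟨u, hu0, hu⟩ := exists_hasDerivWithinAt_Icc_concat (by positivity)
        (le_add_of_nonneg_right hδ.le) hy hz hz0
      refine ⟨u, hu0.trans hy0, ?_⟩
      push_cast
      rw [add_mul, one_mul]
      exact hu
  have key' : ∀ T : ℝ, ∃ y : ℝ → E, y 0 = y₀ ∧ ∀ t ∈ Icc 0 T,
      HasDerivWithinAt y (f (y t)) (Icc 0 T) t := by
    intro T
    obtain ⟨k, hk⟩ := exists_nat_ge (T / (1 / ((K : ℝ) + 1)))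
    obtain ⟨y, hy0, hy⟩ := key k
    have hT := (div_le_iff₀ hδ).1 hk
    exact ⟨y, hy0, fun t ht ↦ (hy t ⟨ht.1, ht.2.trans hT⟩).mono (Icc_subset_Icc_right hT)⟩
  choose Y hY0 hY using key'
  have hright : ∀ T, ∀ t ∈ Ico 0 T, HasDerivWithinAt (Y T) (f (Y T t)) (Ici t) t := by
    intro T t ht
    refine (hY T t ⟨ht.1, ht.2.le⟩).mono_of_mem_nhdsWithin ?_
    filter_upwards [self_mem_nhdsWithin, mem_nhdsWithin_of_mem_nhds (Iio_mem_nhds ht.2)]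
      with s hs hs'
    exact ⟨ht.1.trans hs, le_of_lt hs'⟩
  have hcont : ∀ T, ContinuousOn (Y T) (Icc 0 T) := fun T t ht ↦ (hY T t ht).continuousWithinAt
  have heq : ∀ S T, S ≤ T → EqOn (Y S) (Y T) (Icc 0 S) := by
    intro S T hST
    exact ODE_solution_unique (v := fun _ ↦ f) (fun _ ↦ hf) (hcont S) (hright S)
      ((hcont T).mono (Icc_subset_Icc_right hST))
      (fun t ht ↦ hright T t ⟨ht.1, ht.2.trans_le hST⟩) ((hY0 S).trans (hY0 T).symm)
  -- Solving up to `t + 1` keeps `t` away from the right endpoint, so one `Y (t + 1)` represents the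
  -- glued solution near `t`.
  refine ⟨fun t ↦ Y (t + 1) t, by simp [hY0], fun t ht ↦ ?_⟩
  have hYt : ∀ s ∈ Ico 0 (t + 1), Y (s + 1) s = Y (t + 1) s := by
    intro s hs
    rcases le_total s t with h | h
    · exact heq (s + 1) (t + 1) (by linarith) ⟨hs.1, by linarith⟩
    · exact (heq (t + 1) (s + 1) (by linarith) ⟨hs.1, hs.2.le⟩).symm
  have hmem : Ico 0 (t + 1) ∈ 𝓝[Ici 0] t := by
    filter_upwards [self_mem_nhdsWithin,
      mem_nhdsWithin_of_mem_nhds (Iio_mem_nhds (lt_add_one t))] with s hs hs'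
    exact ⟨hs, hs'⟩
  have h1 : HasDerivWithinAt (Y (t + 1)) (f (Y (t + 1) t)) (Ici 0) t :=
    (hY (t + 1) t ⟨ht, by linarith⟩).mono_of_mem_nhdsWithin
      (mem_of_superset hmem Ico_subset_Icc_self)
  refine h1.congr_of_eventuallyEq ?_ rfl
  filter_upwards [hmem] with s hs using hYt s hs

end GlobalExistence

/-! ### Lyapunov estimate and exponential decay. -/

section Lyapunov

variable {E : Type*} [NormedAddCommGroup E] [InnerProductSpace ℝ E]

/-- The Lyapunov function of the Heavy Anchor dynamics. -/
noncomputable def anchorLyapunov (G : E → E) (d : ℝ) (p r x : E) : ℝ :=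
  (1 - d) / 2 * ‖r - p‖ ^ 2 + d / 2 * ‖x - G r‖ ^ 2

/-- Majorant of the difference quotient of `anchorLyapunov` over a step `h` with average
velocities `b` of the anchor and `a` of the state. -/
noncomputable def anchorLyapunovSlope (G : E → E) (d α L : ℝ) (p r x : E) (h : ℝ) (b a : E) : ℝ :=
  (1 - d) * (inner ℝ (r - p) b + h / 2 * ‖b‖ ^ 2) +
  d * (inner ℝ (x - G r) a +
    α⁻¹ * (‖α • (x - G r) - (b - α • (G r - r))‖ * (L * ‖b - α • (G r - r)‖)) +
    ‖x - G r‖ * (L * (α * ‖G r - r‖)) + h / 2 * (‖a‖ + L * ‖b‖) ^ 2)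

/-- Moving `r` by `h • b` is split at `r + h • (α • w)`. Along the dynamics the leftover velocity `b
- α • w` tends to `α • z`, so monotonicity of `G` makes the first part harmless up to a vanishing
error; only the second costs a Lipschitz bound. -/
lemma neg_inner_sub_le_of_monotone {G : E → E} {α L h : ℝ} (hα : 0 < α) (hh : 0 < h)
    (hLip : ∀ r s, ‖G r - G s‖ ≤ L * ‖r - s‖) (hmono : ∀ r s, 0 ≤ inner ℝ (G r - G s) (r - s))
    (r b w z : E) :
    -inner ℝ z (G (r + h • b) - G r) ≤
      h * (α⁻¹ * (‖α • z - (b - α • w)‖ * (L * ‖b - α • w‖)) + ‖z‖ * (L * (α * ‖w‖))) := by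
  set e := b - α • w with he
  set D₁ := G (r + h • b) - G (r + h • (α • w)) with hD₁
  set D₂ := G (r + h • (α • w)) - G r with hD₂
  have hD : G (r + h • b) - G r = D₁ + D₂ := by rw [hD₁, hD₂]; abel
  have hre : r + h • b - (r + h • (α • w)) = h • e := by rw [he, smul_sub]; abel
  have hn₁ : ‖D₁‖ ≤ L * (h * ‖e‖) := by
    have := hLip (r + h • b) (r + h • (α • w))
    rwa [hre, norm_smul, Real.norm_of_nonneg hh.le] at this
  have hn₂ : ‖D₂‖ ≤ L * (h * (α * ‖w‖)) := by
    have := hLip (r + h • (α • w)) r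
    rwa [add_sub_cancel_left, norm_smul, norm_smul, Real.norm_of_nonneg hh.le,
      Real.norm_of_nonneg hα.le] at this
  have hpos : 0 ≤ inner ℝ e D₁ := by
    have := hmono (r + h • b) (r + h • (α • w))
    rw [hre, inner_smul_right, real_inner_comm] at this
    exact nonneg_of_mul_nonneg_right this hh
  have h₁ : -inner ℝ (α • z) D₁ ≤ ‖α • z - e‖ * (L * (h * ‖e‖)) := by
    have h2 : inner ℝ (α • z - e) D₁ = inner ℝ (α • z) D₁ - inner ℝ e D₁ := inner_sub_left _ _ _
    have h3 : -inner ℝ (α • z - e) D₁ ≤ ‖α • z - e‖ * ‖D₁‖ := by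
      rw [← inner_neg_left, ← norm_neg (α • z - e)]
      exact real_inner_le_norm _ _
    have h4 := mul_le_mul_of_nonneg_left hn₁ (norm_nonneg (α • z - e))
    linarith
  have h₁' : -inner ℝ z D₁ ≤ α⁻¹ * (‖α • z - e‖ * (L * (h * ‖e‖))) := by
    rw [inner_smul_left] at h₁
    have := mul_le_mul_of_nonneg_left h₁ (inv_pos.2 hα).le
    have h5 : α⁻¹ * -((starRingEnd ℝ) α * inner ℝ z D₁) = -inner ℝ z D₁ := by
      simp only [conj_trivial]
      field_simp
    linarith
  have h₂ : -inner ℝ z D₂ ≤ ‖z‖ * (L * (h * (α * ‖w‖))) := by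
    have h3 : -inner ℝ z D₂ ≤ ‖z‖ * ‖D₂‖ := by
      rw [← inner_neg_left, ← norm_neg z]
      exact real_inner_le_norm _ _
    exact h3.trans (mul_le_mul_of_nonneg_left hn₂ (norm_nonneg z))
  rw [hD, inner_add_right]
  linarith

lemma anchorLyapunov_sub_le {G : E → E} {d α L h : ℝ} (hd0 : 0 < d)
    (hα : 0 < α) (hh : 0 < h)
    (hLip : ∀ r s, ‖G r - G s‖ ≤ L * ‖r - s‖) (hmono : ∀ r s, 0 ≤ inner ℝ (G r - G s) (r - s))
    (p r x b a : E) :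
    anchorLyapunov G d p (r + h • b) (x + h • a) - anchorLyapunov G d p r x ≤
      h * anchorLyapunovSlope G d α L p r x h b a := by
  have h1 : ‖r + h • b - p‖ ^ 2 = ‖r - p‖ ^ 2 + 2 * h * inner ℝ (r - p) b + h ^ 2 * ‖b‖ ^ 2 := by
    rw [add_sub_right_comm, norm_add_sq_real, inner_smul_right, norm_smul,
      Real.norm_of_nonneg hh.le]
    ring
  set D := G (r + h • b) - G r with hD
  have hDn : ‖D‖ ≤ L * (h * ‖b‖) := by
    have := hLip (r + h • b) r
    rwa [add_sub_cancel_left, norm_smul, Real.norm_of_nonneg hh.le] at this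
  have h2 : x + h • a - G (r + h • b) = (x - G r) + (h • a - D) := by rw [hD]; abel
  have h3 : ‖h • a - D‖ ≤ h * (‖a‖ + L * ‖b‖) := by
    have := norm_sub_le (h • a) D
    rw [norm_smul, Real.norm_of_nonneg hh.le] at this
    linarith
  have h4 : ‖h • a - D‖ ^ 2 ≤ (h * (‖a‖ + L * ‖b‖)) ^ 2 :=
    pow_le_pow_left₀ (norm_nonneg _) h3 2
  have h5 : ‖x + h • a - G (r + h • b)‖ ^ 2 =
      ‖x - G r‖ ^ 2 + 2 * (h * inner ℝ (x - G r) a - inner ℝ (x - G r) D) + ‖h • a - D‖ ^ 2 := by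
    rw [h2, norm_add_sq_real, inner_sub_right, inner_smul_right]
  have h6 := neg_inner_sub_le_of_monotone hα hh hLip hmono r b (G r - r) (x - G r)
  have h7 : ‖x + h • a - G (r + h • b)‖ ^ 2 - ‖x - G r‖ ^ 2 ≤
      2 * (h * (inner ℝ (x - G r) a +
    α⁻¹ * (‖α • (x - G r) - (b - α • (G r - r))‖ * (L * ‖b - α • (G r - r)‖)) +
    ‖x - G r‖ * (L * (α * ‖G r - r‖)) + h / 2 * (‖a‖ + L * ‖b‖) ^ 2)) := by
    rw [h5]
    linarith
  have h8 := mul_le_mul_of_nonneg_left h7 hd0.le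
  unfold anchorLyapunov anchorLyapunovSlope
  rw [h1]
  linarith

lemma anchorLyapunovSlope_zero_le {F G : E → E} {d α β μ L κ : ℝ} (hd0 : 0 < d) (hd1 : d < 1)
    (hα : 0 < α) (hL : 0 ≤ L)
    (hLip : ∀ r s, ‖G r - G s‖ ≤ L * ‖r - s‖)
    (hκ : ∀ r s, inner ℝ (G r - G s) (r - s) ≤ κ * ‖r - s‖ ^ 2)
    (hF : ∀ x y, -μ * ‖x - y‖ ^ 2 ≤ inner ℝ (F x - F y) (x - y))
    (hG : ∀ r, F (G r) = β • (r - G r)) {p : E} (hp : G p = p) (r x : E) :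
    anchorLyapunovSlope G d α L p r x 0 (α • (x - r)) (-F x - β • (x - r)) ≤
      -((1 - d) * α * (1 - κ)) * ‖r - p‖ ^ 2 - d * (β - μ) * ‖x - G r‖ ^ 2 +
        α * ((1 - d) + d * (L + L ^ 2)) * ‖r - p‖ * ‖x - G r‖ := by
  set z := x - G r with hz
  set w := G r - r with hw
  set ρ := r - p with hρ
  have hxr : x - r = z + w := by rw [hz, hw]; abel
  have hb : α • (x - r) - α • w = α • z := by rw [hxr, smul_add]; abel
  have h1 : inner ℝ ρ (α • (x - r)) ≤ α * (‖ρ‖ * ‖z‖ - (1 - κ) * ‖ρ‖ ^ 2) := by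
    rw [inner_smul_right]
    refine mul_le_mul_of_nonneg_left ?_ hα.le
    have h2 : w = (G r - G p) - ρ := by rw [hw, hρ, hp]; abel
    rw [hxr, inner_add_right, h2, inner_sub_right ρ (G r - G p) ρ, real_inner_self_eq_norm_sq,
      real_inner_comm (G r - G p) ρ]
    have h3 := hκ r p
    have h4 := real_inner_le_norm ρ z
    change inner ℝ (G r - G p) ρ ≤ κ * ‖ρ‖ ^ 2 at h3
    linarith
  -- Since `G r` is the rest point for anchor `r`, the velocity of `x` is `-(F x - F (G r)) - β •
  -- z`, and hypomonotonicity costs only `μ` of the damping `β`.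
  have h5 : inner ℝ z (-F x - β • (x - r)) ≤ -(β - μ) * ‖z‖ ^ 2 := by
    have h6 : -F x - β • (x - r) = -(F x - F (G r)) - β • z := by
      rw [hG, hz]; module
    have h7 := hF x (G r)
    rw [h6, inner_sub_right, inner_neg_right, inner_smul_right, real_inner_self_eq_norm_sq,
      real_inner_comm]
    linarith
  have h8 : ‖w‖ ≤ (1 + L) * ‖ρ‖ := by
    have h2 : w = (G r - G p) - ρ := by rw [hw, hρ, hp]; abel
    have := norm_sub_le (G r - G p) ρ
    have h9 := hLip r p
    rw [h2]
    linarith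
  have h10 : ‖z‖ * (L * (α * ‖w‖)) ≤ ‖z‖ * (L * (α * ((1 + L) * ‖ρ‖))) := by gcongr
  unfold anchorLyapunovSlope
  rw [← hz, ← hw, ← hρ, hb, sub_self, norm_zero]
  have h11 := mul_le_mul_of_nonneg_left h1 (sub_pos.2 hd1).le
  have h12 := mul_le_mul_of_nonneg_left (add_le_add h5 h10) hd0.le
  linarith

lemma quadraticForm_coercive {A B D : ℝ} (hA : 0 < A) (hB : 0 < B) (hD : D ^ 2 < 4 * A * B) :
    ∃ ε > 0, ∀ u v : ℝ, -A * u ^ 2 - B * v ^ 2 + D * u * v ≤ -ε * (u ^ 2 + v ^ 2) := by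
  have hAB : 0 < A + B := by positivity
  -- This choice gives `4(A - ε)(B - ε) = D² + 4ε²`, so the form shifted by `ε` is still
  -- nonnegative.
  set ε := (4 * A * B - D ^ 2) / (4 * (A + B)) with hε
  have hε0 : 0 < ε := div_pos (by linarith) (by positivity)
  have hεm : ε * (4 * (A + B)) = 4 * A * B - D ^ 2 := div_mul_cancel₀ _ (by positivity)
  refine ⟨ε, hε0, fun u v ↦ ?_⟩
  have hεA : 0 < A - ε := by
    have : 0 < (A - ε) * (4 * (A + B)) := by nlinarith [sq_nonneg D]
    exact pos_of_mul_pos_left this (by positivity)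
  have hdet : D ^ 2 ≤ 4 * ((A - ε) * (B - ε)) := by nlinarith [sq_nonneg ε]
  have : 0 ≤ (A - ε) * ((A - ε) * u ^ 2 + (B - ε) * v ^ 2 - D * u * v) := by
    nlinarith [sq_nonneg (2 * (A - ε) * u - D * v), mul_nonneg (sub_nonneg.2 hdet) (sq_nonneg v)]
  have := nonneg_of_mul_nonneg_right this hεA
  linarith

lemma tendsto_of_isHeavyAnchorSolution {F G : E → E} {d α β μ L κ : ℝ} (hd0 : 0 < d) (hd1 : d < 1)
    (hα : 0 < α) (hL : 0 ≤ L) (hμβ : μ < β) (hκ1 : κ < 1)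
    (hαd : α * ((1 - d) + d * (L + L ^ 2)) ^ 2 < 4 * d * (1 - d) * (β - μ) * (1 - κ))
    (hLip : ∀ r s, ‖G r - G s‖ ≤ L * ‖r - s‖) (hmono : ∀ r s, 0 ≤ inner ℝ (G r - G s) (r - s))
    (hκ : ∀ r s, inner ℝ (G r - G s) (r - s) ≤ κ * ‖r - s‖ ^ 2)
    (hF : ∀ x y, -μ * ‖x - y‖ ^ 2 ≤ inner ℝ (F x - F y) (x - y))
    (hG : ∀ r, F (G r) = β • (r - G r)) {p : E} (hp : G p = p) {r x : ℝ → E}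
    (hsol : IsHeavyAnchorSolution F α β r x) :
    Tendsto x atTop (𝓝 p) ∧ Tendsto r atTop (𝓝 p) := by
  have hd1' : 0 < 1 - d := sub_pos.2 hd1
  obtain ⟨ε, hε, hquad⟩ := quadraticForm_coercive (A := (1 - d) * α * (1 - κ)) (B := d * (β - μ))
    (D := α * ((1 - d) + d * (L + L ^ 2)))
    (mul_pos (mul_pos hd1' hα) (sub_pos.2 hκ1)) (mul_pos hd0 (sub_pos.2 hμβ))
    (by have := mul_lt_mul_of_pos_left hαd hα; linarith)
  have hGcont : Continuous G := by
    refine LipschitzWith.continuous (K := ⟨L, hL⟩) (LipschitzWith.of_dist_le_mul fun a b ↦ ?_)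
    rw [dist_eq_norm, dist_eq_norm]
    exact hLip a b
  have hrc : ContinuousOn r (Ici 0) := fun t ht ↦ (hsol t ht).1.continuousWithinAt
  have hxc : ContinuousOn x (Ici 0) := fun t ht ↦ (hsol t ht).2.continuousWithinAt
  set V : ℝ → ℝ := fun t ↦ anchorLyapunov G d p (r t) (x t) with hV
  have hVc : ContinuousOn V (Ici 0) := by
    have := hGcont.comp_continuousOn hrc
    simp only [hV, anchorLyapunov]
    fun_prop
  -- The majorant is continuous in the step and the average velocities, so its value at step `0`
  -- bounds the right Dini derivative of `V`.
  have hslope : ∀ t, 0 ≤ t → ∀ c,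
      anchorLyapunovSlope G d α L p (r t) (x t) 0 (α • (x t - r t))
        (-F (x t) - β • (x t - r t)) < c →
      ∃ᶠ s in 𝓝[>] t, (s - t)⁻¹ * (V s - V t) < c := by
    intro t ht c hc
    have hsub : Ioi t ⊆ Ici 0 := fun s hs ↦ ht.trans (le_of_lt hs)
    have hr' : Tendsto (slope r t) (𝓝[>] t) (𝓝 (α • (x t - r t))) :=
      (hasDerivWithinAt_iff_tendsto_slope' (lt_irrefl t)).1 ((hsol t ht).1.mono hsub)
    have hx' : Tendsto (slope x t) (𝓝[>] t) (𝓝 (-F (x t) - β • (x t - r t))) :=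
      (hasDerivWithinAt_iff_tendsto_slope' (lt_irrefl t)).1 ((hsol t ht).2.mono hsub)
    have hh' : Tendsto (fun s ↦ s - t) (𝓝[>] t) (𝓝 0) := by
      have : Tendsto (fun s ↦ s - t) (𝓝 t) (𝓝 (t - t)) := (continuous_sub_right t).tendsto t
      rw [sub_self] at this
      exact this.mono_left nhdsWithin_le_nhds
    have hcont : Continuous fun q : ℝ × E × E ↦
        anchorLyapunovSlope G d α L p (r t) (x t) q.1 q.2.1 q.2.2 := by
      unfold anchorLyapunovSlope
      fun_prop
    have hlim := (hcont.tendsto (0, α • (x t - r t), -F (x t) - β • (x t - r t))).comp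
      (hh'.prodMk_nhds (hr'.prodMk_nhds hx'))
    refine Eventually.frequently ?_
    filter_upwards [hlim.eventually_lt_const hc, self_mem_nhdsWithin] with s hs hst
    have hst' : 0 < s - t := sub_pos.2 hst
    refine lt_of_le_of_lt ?_ hs
    rw [inv_mul_le_iff₀ hst']
    have hstep := anchorLyapunov_sub_le hd0 hα hst' hLip hmono p (r t) (x t)
      (slope r t s) (slope x t s)
    have e : ∀ f : ℝ → E, f t + (s - t) • slope f t s = f s := fun f ↦ by
      rw [sub_smul_slope, vsub_eq_sub]; abel
    rwa [e r, e x] at hstep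
  have hbound : ∀ t, 0 ≤ t →
      anchorLyapunovSlope G d α L p (r t) (x t) 0 (α • (x t - r t))
        (-F (x t) - β • (x t - r t)) ≤ -ε * V t + 0 := by
    intro t _
    refine (anchorLyapunovSlope_zero_le hd0 hd1 hα hL hLip hκ hF hG hp (r t) (x t)).trans ?_
    refine (hquad ‖r t - p‖ ‖x t - G (r t)‖).trans ?_
    have : V t ≤ ‖r t - p‖ ^ 2 + ‖x t - G (r t)‖ ^ 2 := by
      simp only [hV, anchorLyapunov]
      nlinarith [sq_nonneg ‖r t - p‖, sq_nonneg ‖x t - G (r t)‖]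
    nlinarith
  have hdecay : ∀ T, 0 ≤ T → V T ≤ V 0 * Real.exp (-ε * T) := by
    intro T hT
    have := le_gronwallBound_of_liminf_deriv_right_le (f := V) (δ := V 0) (K := -ε) (ε := 0)
      (a := 0) (b := T) (hVc.mono fun s hs ↦ hs.1) (fun t ht ↦ hslope t ht.1) le_rfl
      (fun t ht ↦ hbound t ht.1) T ⟨hT, le_rfl⟩
    rwa [gronwallBound_ε0, sub_zero] at this
  have hV0 : Tendsto V atTop (𝓝 0) := by
    have hexp : Tendsto (fun T ↦ V 0 * Real.exp (-ε * T)) atTop (𝓝 0) := by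
      have h1 : Tendsto (fun T : ℝ ↦ -ε * T) atTop atBot :=
        tendsto_id.const_mul_atTop_of_neg (neg_lt_zero.2 hε)
      simpa using (Real.tendsto_exp_atBot.comp h1).const_mul (V 0)
    refine squeeze_zero' (Eventually.of_forall fun t ↦ ?_) ?_ hexp
    · simp only [hV, anchorLyapunov]
      positivity
    · filter_upwards [eventually_ge_atTop 0] with T hT using hdecay T hT
  have hsq : ∀ (f : ℝ → E) (c : ℝ), 0 < c → (∀ t, c * ‖f t‖ ^ 2 ≤ V t) →
      Tendsto f atTop (𝓝 0) := by
    intro f c hc hf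
    have h1 : Tendsto (fun t ↦ c⁻¹ * V t) atTop (𝓝 0) := by simpa using hV0.const_mul c⁻¹
    have h2 : Tendsto (fun t ↦ ‖f t‖ ^ 2) atTop (𝓝 0) :=
      squeeze_zero (fun t ↦ sq_nonneg _) (fun t ↦ (le_inv_mul_iff₀ hc).2 (hf t)) h1
    rw [tendsto_zero_iff_norm_tendsto_zero]
    simpa using h2.sqrt
  have hr : Tendsto r atTop (𝓝 p) := by
    rw [← tendsto_sub_nhds_zero_iff]
    refine hsq _ ((1 - d) / 2) (by positivity) fun t ↦ ?_
    have : 0 ≤ d / 2 * ‖x t - G (r t)‖ ^ 2 := by positivity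
    simp only [hV, anchorLyapunov]
    linarith
  have hz : Tendsto (fun t ↦ x t - G (r t)) atTop (𝓝 0) := by
    refine hsq _ (d / 2) (by positivity) fun t ↦ ?_
    have : 0 ≤ (1 - d) / 2 * ‖r t - p‖ ^ 2 := by positivity
    simp only [hV, anchorLyapunov]
    linarith
  refine ⟨?_, hr⟩
  have := hz.add ((hGcont.tendsto p).comp hr)
  simpa [hp] using this

end Lyapunov

/-! ### The resolvent and its constants. -/

section Resolvent

variable {E : Type*} [NormedAddCommGroup E] [InnerProductSpace ℝ E]

/-- A Lipschitz strongly monotone operator has a zero. -/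
lemma exists_eq_zero_of_stronglyMonotone [CompleteSpace E] {T : E → E} {c K : ℝ} (hc : 0 < c)
    (hmono : ∀ x y, c * ‖x - y‖ ^ 2 ≤ inner ℝ (T x - T y) (x - y))
    (hLip : ∀ x y, ‖T x - T y‖ ≤ K * ‖x - y‖) : ∃ x, T x = 0 := by
  have hKc : 0 < K ^ 2 + c ^ 2 := by positivity
  -- With this step size `ε²K² ≤ εc`, so `x ↦ x - ε • T x` shrinks squared distances by `1 - 2εc +
  -- ε²K² ≤ 1 - εc`.
  set ε := c / (K ^ 2 + c ^ 2) with hε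
  have hε0 : 0 < ε := div_pos hc hKc
  have hεm : ε * (K ^ 2 + c ^ 2) = c := div_mul_cancel₀ _ hKc.ne'
  have hεK : ε ^ 2 * K ^ 2 ≤ ε * c := by
    nlinarith [mul_nonneg hε0.le (mul_nonneg hε0.le (sq_nonneg c))]
  have hstep : ∀ x y, ‖(x - ε • T x) - (y - ε • T y)‖ ≤ √(1 - ε * c) * ‖x - y‖ := by
    intro x y
    have h1 : (x - ε • T x) - (y - ε • T y) = (x - y) - ε • (T x - T y) := by module
    have h2 : ‖(x - ε • T x) - (y - ε • T y)‖ ^ 2 ≤ (1 - ε * c) * ‖x - y‖ ^ 2 := by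
      rw [h1, norm_sub_sq_real, inner_smul_right, norm_smul, Real.norm_of_nonneg hε0.le,
        real_inner_comm]
      have h3 := mul_le_mul_of_nonneg_left (hmono x y) hε0.le
      have h4 : ‖T x - T y‖ ^ 2 ≤ (K * ‖x - y‖) ^ 2 :=
        pow_le_pow_left₀ (norm_nonneg _) (hLip x y) 2
      have h5 := mul_le_mul_of_nonneg_left h4 (sq_nonneg ε)
      have h6 := mul_le_mul_of_nonneg_right hεK (sq_nonneg ‖x - y‖)
      linarith
    have h3 := Real.sqrt_le_sqrt h2
    rwa [Real.sqrt_sq (norm_nonneg _), Real.sqrt_mul' _ (sq_nonneg _),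
      Real.sqrt_sq (norm_nonneg _)] at h3
  have hcontr : ContractingWith (Real.toNNReal √(1 - ε * c)) fun x ↦ x - ε • T x := by
    refine ⟨?_, LipschitzWith.of_dist_le_mul fun x y ↦ ?_⟩
    · rw [Real.toNNReal_lt_one, Real.sqrt_lt' one_pos]
      nlinarith [mul_pos hε0 hc]
    · rw [dist_eq_norm, dist_eq_norm, Real.coe_toNNReal _ (Real.sqrt_nonneg _)]
      exact hstep x y
  have : Nonempty E := ⟨0⟩
  refine ⟨ContractingWith.fixedPoint _ hcontr, ?_⟩
  have hfix := hcontr.fixedPoint_isFixedPt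
  have h := sub_eq_self.1 hfix
  exact (smul_eq_zero.1 h).resolve_left hε0.ne'

lemma resolvent_denominator_pos {R μ lam : ℝ} (hlam : 0 < lam) (h1 : μ * lam < 1)
    (h2 : μ * R ^ 2 < lam) : 0 < R ^ 2 + lam ^ 2 - 2 * lam * μ * R ^ 2 := by
  rcases le_total (R ^ 2) (lam ^ 2) with h | h
  · rcases h.eq_or_lt with h | h
    · nlinarith
    · nlinarith [mul_nonneg (sq_nonneg R) (sub_pos.2 h1).le]
  · nlinarith

lemma resolventKappa_lt_one {R μ lam : ℝ} (hR : 0 < R) (hlam : 0 < lam) (h1 : μ * lam < 1)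
    (h2 : μ * R ^ 2 < lam) : resolventKappa μ R lam < 1 := by
  have hD := resolvent_denominator_pos hlam h1 h2
  unfold resolventKappa
  split_ifs with h
  · rw [div_lt_one (by linarith)]
    nlinarith
  · rw [div_lt_one (by positivity)]
    have : R ^ 2 * (1 + lam / R) = R ^ 2 + R * lam := by field_simp
    rw [this]
    nlinarith [mul_pos hR hlam, sq_pos_of_pos hlam]

/-- Meant for `u = G r - G s` and `v = (r - s) - u`, which is `lam` times the corresponding
increment of `F`. -/
lemma norm_le_resolventLip_mul {R μ lam : ℝ} (hlam : 0 < lam) (h1 : μ * lam < 1)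
    (h2 : μ * R ^ 2 < lam) {u v : E} (huv : lam * ‖u‖ ≤ R * ‖v‖)
    (hin : -(μ * lam) * ‖u‖ ^ 2 ≤ inner ℝ v u) :
    ‖u‖ ≤ resolventLip μ R lam * ‖u + v‖ := by
  have hD := resolvent_denominator_pos hlam h1 h2
  have hsq : lam ^ 2 * ‖u‖ ^ 2 ≤ R ^ 2 * ‖v‖ ^ 2 := by
    have := pow_le_pow_left₀ (by positivity) huv 2
    linarith
  have hmain : ‖u‖ ^ 2 ≤ R ^ 2 / (R ^ 2 + lam ^ 2 - 2 * lam * μ * R ^ 2) * ‖u + v‖ ^ 2 := by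
    rw [div_mul_eq_mul_div, le_div_iff₀ hD, norm_add_sq_real, real_inner_comm]
    have := mul_le_mul_of_nonneg_left hin (sq_nonneg R)
    linarith
  have h3 := Real.sqrt_le_sqrt hmain
  rwa [Real.sqrt_sq (norm_nonneg _), Real.sqrt_mul' _ (sq_nonneg _),
    Real.sqrt_sq (norm_nonneg _)] at h3

lemma inner_le_resolventKappa_mul {R μ lam : ℝ} (hR : 0 < R) (hlam : 0 < lam) (h1 : μ * lam < 1)
    (h2 : μ * R ^ 2 < lam) {u v : E} (huv : lam * ‖u‖ ≤ R * ‖v‖)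
    (hin : -(μ * lam) * ‖u‖ ^ 2 ≤ inner ℝ v u) :
    inner ℝ u (u + v) ≤ resolventKappa μ R lam * ‖u + v‖ ^ 2 := by
  have hD := resolvent_denominator_pos hlam h1 h2
  rw [inner_add_right, real_inner_self_eq_norm_sq, norm_add_sq_real]
  have hsq : lam ^ 2 * ‖u‖ ^ 2 ≤ R ^ 2 * ‖v‖ ^ 2 := by
    have := pow_le_pow_left₀ (by positivity) huv 2
    linarith
  rw [real_inner_comm] at hin
  have hcs := real_inner_le_norm u v
  unfold resolventKappa
  split_ifs with h
  · rw [div_mul_eq_mul_div, le_div_iff₀ (by linarith)]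
    have hlR : 0 ≤ R ^ 2 - lam ^ 2 := by nlinarith
    -- The claim is `R² - lam²` times hypomonotonicity plus `1 - μ lam` times the squared inverse
    -- Lipschitz bound.
    have h3 := mul_le_mul_of_nonneg_left hin hlR
    have h4 := mul_le_mul_of_nonneg_left hsq (sub_pos.2 h1).le
    linarith
  · push Not at h
    have e : R ^ 2 * (1 + lam / R) / (R ^ 2 + lam ^ 2 + 2 * lam * R) = R / (R + lam) := by
      have : 0 < R + lam := by positivity
      rw [div_eq_div_iff (by positivity) (by positivity)]
      field_simp
      ring
    rw [e, div_mul_eq_mul_div, le_div_iff₀ (by positivity)]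
    -- Here `lam > R`, so Cauchy–Schwarz replaces hypomonotonicity; what remains factors as `(‖u‖ +
    -- ‖v‖)(R‖v‖ - lam‖u‖) ≥ 0`.
    have h3 := mul_le_mul_of_nonneg_left hcs (sub_pos.2 h).le
    have h4 := mul_nonneg (add_nonneg (norm_nonneg u) (norm_nonneg v)) (sub_nonneg.2 huv)
    linarith

/-- The resolvent `(id + β⁻¹ F)⁻¹`. -/
lemma exists_resolvent [CompleteSpace E] {F : E → E} {K : ℝ≥0} {β μ : ℝ} (hβ : μ < β)
    (hLip : LipschitzWith K F)
    (hF : ∀ x y, -μ * ‖x - y‖ ^ 2 ≤ inner ℝ (F x - F y) (x - y)) :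
    ∃ G : E → E, ∀ r, F (G r) = β • (r - G r) := by
  have key : ∀ r, ∃ y, F y - β • (r - y) = 0 := by
    intro r
    refine exists_eq_zero_of_stronglyMonotone (c := β - μ) (K := K + |β|) (sub_pos.2 hβ)
      (fun x y ↦ ?_) fun x y ↦ ?_
    · have e : F x - β • (r - x) - (F y - β • (r - y)) = (F x - F y) + β • (x - y) := by module
      rw [e, inner_add_left, real_inner_smul_left, real_inner_self_eq_norm_sq]
      linarith [hF x y]
    · have e : F x - β • (r - x) - (F y - β • (r - y)) = (F x - F y) + β • (x - y) := by module
      rw [e]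
      have h1 := norm_add_le (F x - F y) (β • (x - y))
      have h2 := hLip.norm_sub_le x y
      rw [norm_smul, Real.norm_eq_abs] at h1
      linarith
  choose G hG using key
  exact ⟨G, fun r ↦ sub_eq_zero.1 (hG r)⟩

end Resolvent

/-! ### Solutions of the Heavy Anchor system. -/

section Dynamics

variable {E : Type*} [NormedAddCommGroup E] [NormedSpace ℝ E]

lemma exists_isHeavyAnchorSolution [CompleteSpace E] {F : E → E} {K : ℝ≥0}
    (hF : LipschitzWith K F) (α β : ℝ) (r₀ x₀ : E) :
    ∃ r x : ℝ → E, IsHeavyAnchorSolution F α β r x ∧ r 0 = r₀ ∧ x 0 = x₀ := by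
  have hsub : LipschitzWith (1 + 1) fun q : E × E ↦ q.2 - q.1 :=
    LipschitzWith.prod_snd.sub LipschitzWith.prod_fst
  have h1 := (lipschitzWith_smul α).comp hsub
  have h2 := (hF.comp LipschitzWith.prod_snd).neg.sub ((lipschitzWith_smul β).comp hsub)
  obtain ⟨y, hy0, hy⟩ := exists_hasDerivWithinAt_Ici_of_lipschitzWith (h1.prodMk h2) (r₀, x₀)
  refine ⟨fun t ↦ (y t).1, fun t ↦ (y t).2, fun t ht ↦ ⟨?_, ?_⟩, by simp [hy0], by simp [hy0]⟩
  · exact (ContinuousLinearMap.fst ℝ E E).hasFDerivAt.comp_hasDerivWithinAt t (hy t ht)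
  · exact (ContinuousLinearMap.snd ℝ E E).hasFDerivAt.comp_hasDerivWithinAt t (hy t ht)

end Dynamics

/-! ### Zeros of the pseudo-gradient are Nash equilibria. -/

section Nash

lemma ConvexOn.le_of_gradient_eq_zero {E : Type*} [NormedAddCommGroup E] [InnerProductSpace ℝ E]
    [CompleteSpace E] {f : E → ℝ} {p : E} (hf : ConvexOn ℝ univ f) (hd : DifferentiableAt ℝ f p)
    (h0 : gradient f p = 0) (y : E) : f p ≤ f y := by
  have hg : HasFDerivAt f (0 : E →L[ℝ] ℝ) p := by
    have := hd.hasGradientAt.hasFDerivAt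
    rwa [h0, map_zero] at this
  have hline : HasDerivAt (AffineMap.lineMap p y : ℝ → E) (y - p) 0 := AffineMap.hasDerivAt_lineMap
  have hderiv : HasDerivAt (f ∘ (AffineMap.lineMap p y : ℝ → E)) 0 0 := by
    have hg' : HasFDerivAt f (0 : E →L[ℝ] ℝ) (AffineMap.lineMap p y (0 : ℝ)) := by
      rwa [AffineMap.lineMap_apply_zero]
    exact hg'.comp_hasDerivAt 0 hline
  have hconv : ConvexOn ℝ univ (f ∘ (AffineMap.lineMap p y : ℝ → E)) :=
    hf.comp_affineMap (AffineMap.lineMap p y)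
  have hmin := hconv.isMinOn_of_rightDeriv_eq_zero (x := 0) (by simp)
    (hderiv.hasDerivWithinAt.derivWithin (uniqueDiffWithinAt_Ioi 0)) (mem_univ 1)
  simpa using hmin

variable {N : ℕ} {n : Fin N → ℕ}

lemma deviate_self (x : Profile n) (i : Fin N) : deviate x i (x i) = x := by
  simp [deviate]

lemma differentiable_deviate (x : Profile n) (i : Fin N) : Differentiable ℝ (deviate x i) := by
  have h : Differentiable ℝ fun y ↦ Function.update (WithLp.ofLp x) i y := fun y ↦
    (hasFDerivAt_update (WithLp.ofLp x) y).differentiableAt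
  exact (PiLp.continuousLinearEquiv 2 ℝ
    (fun i : Fin N ↦ EuclideanSpace ℝ (Fin (n i)))).symm.differentiable.comp h

lemma isNashEquilibrium_of_pseudoGradient_eq_zero {J : Fin N → Profile n → ℝ}
    (hJ : CostAssumption J) {p : Profile n} (hp : pseudoGradient J p = 0) :
    IsNashEquilibrium J p := by
  intro i y
  have hdiff : Differentiable ℝ fun y ↦ J i (deviate p i y) :=
    ((hJ.contDiff i).differentiable one_ne_zero).comp (differentiable_deviate p i)
  have hgrad : gradient (fun y ↦ J i (deviate p i y)) (p i) = 0 :=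
    congrArg (fun q : Profile n ↦ q i) hp
  have := (hJ.convex i p).le_of_gradient_eq_zero (hdiff _) hgrad y
  rwa [deviate_self] at this

end Nash

/-! ### Assembly. -/

theorem mainTheorem4 {N : ℕ} (n : Fin N → ℕ) (J : Fin N → Profile n → ℝ)
    (hJ : CostAssumption J)
    (L_F : ℝ≥0) (R μ : ℝ) (hR : 0 < R)
    (hLip : LipschitzWith L_F (pseudoGradient J))
    (hInv : IsInverseLipschitz R (pseudoGradient J))
    (hHypo : IsHypomonotone μ (pseudoGradient J))
    (d α β : ℝ) (hd0 : 0 < d) (hd1 : d < 1)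
    -- `β ∈ (μ, 1 / (μ R²))`, where `1 / (μ R²) = ∞` if `μ = 0`
    (hβ0 : μ < β) (hβ1 : μ = 0 ∨ β < 1 / (μ * R ^ 2))
    (hα0 : 0 < α)
    (hα1 : α < 4 * d * (1 - d) * (β - μ) * (1 - resolventKappa μ R (1 / β)) /
      ((1 - d) + d * (resolventLip μ R (1 / β) + resolventLip μ R (1 / β) ^ 2)) ^ 2) :
    ∃ xstar : Profile n, IsNashEquilibrium J xstar ∧
      (∀ r₀ x₀ : Profile n, ∃ r x : ℝ → Profile n,
        IsHeavyAnchorSolution (pseudoGradient J) α β r x ∧ r 0 = r₀ ∧ x 0 = x₀) ∧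
      (∀ r x : ℝ → Profile n, IsHeavyAnchorSolution (pseudoGradient J) α β r x →
        Tendsto x atTop (𝓝 xstar) ∧ Tendsto r atTop (𝓝 xstar)) := by
  obtain ⟨hμ, hmonoF⟩ := hHypo
  have hβ : 0 < β := hμ.trans_lt hβ0
  have hlam : 0 < 1 / β := one_div_pos.2 hβ
  have h1 : μ * (1 / β) < 1 := by rwa [mul_one_div, div_lt_one hβ]
  have h2 : μ * R ^ 2 < 1 / β := by
    rcases hμ.eq_or_lt with rfl | hμ'
    · simpa using hβ
    · have hβ' := hβ1.resolve_left hμ'.ne'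
      rwa [lt_one_div (by positivity) hβ]
  have hκ1 := resolventKappa_lt_one hR hlam h1 h2
  set L := resolventLip μ R (1 / β) with hL
  set κ := resolventKappa μ R (1 / β) with hκ
  have hL0 : 0 ≤ L := Real.sqrt_nonneg _
  obtain ⟨G, hG⟩ := exists_resolvent hβ0 hLip hmonoF
  have hbasic : ∀ r s, 1 / β * ‖G r - G s‖ ≤ R * ‖(r - s) - (G r - G s)‖ ∧
      -(μ * (1 / β)) * ‖G r - G s‖ ^ 2 ≤ inner ℝ ((r - s) - (G r - G s)) (G r - G s) := by
    intro r s
    have e : pseudoGradient J (G r) - pseudoGradient J (G s) =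
        β • ((r - s) - (G r - G s)) := by
      rw [hG, hG]; module
    have hi := hInv (G r) (G s)
    have hm := hmonoF (G r) (G s)
    rw [e, norm_smul, Real.norm_of_nonneg hβ.le] at hi
    rw [e, real_inner_smul_left] at hm
    constructor
    · rw [one_div_mul_eq_div, div_le_iff₀ hβ]
      linarith
    · have := mul_le_mul_of_nonneg_left hm hlam.le
      rw [← mul_assoc (1 / β) β, one_div_mul_cancel hβ.ne'] at this
      linarith
  have hGL : ∀ r s, ‖G r - G s‖ ≤ L * ‖r - s‖ := fun r s ↦ by
    have := norm_le_resolventLip_mul hlam h1 h2 (hbasic r s).1 (hbasic r s).2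
    rwa [add_sub_cancel] at this
  have hGκ : ∀ r s, inner ℝ (G r - G s) (r - s) ≤ κ * ‖r - s‖ ^ 2 := fun r s ↦ by
    have := inner_le_resolventKappa_mul hR hlam h1 h2 (hbasic r s).1 (hbasic r s).2
    rwa [add_sub_cancel] at this
  -- The inner product is at least `(1 - μ/β)‖G r - G s‖²`, nonnegative because `μ < β`.
  have hGm : ∀ r s, 0 ≤ inner ℝ (G r - G s) (r - s) := fun r s ↦ by
    have h3 := (hbasic r s).2
    rw [inner_sub_left, real_inner_self_eq_norm_sq, real_inner_comm] at h3
    nlinarith [sq_nonneg ‖G r - G s‖]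
  obtain ⟨p, hp⟩ : ∃ p, p - G p = 0 := by
    refine exists_eq_zero_of_stronglyMonotone (c := 1 - κ) (K := 1 + L) (sub_pos.2 hκ1)
      (fun x y ↦ ?_) fun x y ↦ ?_
    · rw [sub_sub_sub_comm, inner_sub_left, real_inner_self_eq_norm_sq]
      linarith [hGκ x y]
    · rw [sub_sub_sub_comm]
      linarith [norm_sub_le (x - y) (G x - G y), hGL x y]
  have hFp : pseudoGradient J p = 0 := by
    have := hG p
    rwa [hp, smul_zero, ← sub_eq_zero.1 hp] at this
  have hC : 0 < (1 - d) + d * (L + L ^ 2) := by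
    have := sub_pos.2 hd1
    positivity
  exact ⟨p, isNashEquilibrium_of_pseudoGradient_eq_zero hJ hFp,
    fun r₀ x₀ ↦ exists_isHeavyAnchorSolution hLip α β r₀ x₀,
    fun r x hsol ↦ tendsto_of_isHeavyAnchorSolution hd0 hd1 hα0 hL0 hβ0 hκ1
      ((lt_div_iff₀ (by positivity)).1 hα1) hGL hGm hGκ hmonoF hG (sub_eq_zero.1 hp).symm hsol⟩
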